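/- For groups $A,B$ let $A\wr B$ be the (restricted) wreath product $\left(\sum_A B\right)\rtimes A$, where $A$ acts on the finitely supported functions $A\to B$ by shifts. If $\mu_A,\mu_B$ are probability measures on $A,B$, the switch-walk-switch measure on $A\wr B$ is $\mu_B*\mu_A*\mu_B$, where $B$ is embedded as the copy of $B$ at $e\in A$. For a finite generating set $S$ of a group $G$ let $l_S$ be the word length. A random walk $(G,\mu)$ is *individually almost invariant on the scale* $r:\mathbb N\to[0,\infty)$ if for every $\epsilon>0$ and every sequence $g_n\in G$ with $l_S(g_n)\le r(n)$ for all $n$ there are sets $V_n\subset G$ such that for all sufficiently large $n$: $\mu^{*n}(V_n)\ge 1-\epsilon$ and $\left|\mu^{*n}(hg_n)/\mu^{*n}(h)-1\right|\le\epsilon$ for all $h\in V_n$ (with $\mu^{*n}(h)>0$). For $r:\mathbb N\to[0,\infty)$ one writes $\bar r_{(G,\mu)}(n)\preceq r(n)$ (the radius of individual almost invariance is asymptotically at most $r$) if $(G,\mu)$ is not individually almost invariant on the scale $r'$, for every $r':\mathbb N\to[0,\infty)$ such that $r'(n)/r(n)$ tends to infinity along some subsequence. **Corollary.** Let $H$ be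 a group generated by a finite set $S$, and let $\mu_0$ be a symmetric finitely supported probability measure on $H$ whose drift function $L(n)=\sum_{h\in H} l_S(h)\,\mu_0^{*n}(h)$ is asymptotically equivalent to $\sqrt n$, that is, $c\sqrt n\le L(n)\le C\sqrt n$ for some $c,C>0$ and all large $n$. Let $i\ge 0$, let $\nu_0,\dots,\nu_{i-1}$ be symmetric finitely supported probability measures on $\mathbb Z$, and put $G_0=H$, $G_{j+1}=\mathbb Z\wr G_j$ and $\mu_{j+1}=\mu_j*\nu_j*\mu_j$ (the switch-walk-switch measure on $G_{j+1}$) for $0\le j<i$. Then, for the word length of any finite generating set $T$ of $G_i$, $$\bar r_{(G_i,\mu_i)}(n)\preceq n^{1/2^{i+1}}.$$ -/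

import Mathlib

open Filter Topology
open scoped NNReal ENNReal Asymptotics

universe u

noncomputable section

/-! ### Words and word length -/

/-- The word length of `g` with respect to `S`: the least length of a word in the letters of `S`
and their inverses that represents `g`. (It is used for generating sets `S` only.) -/
def wordLength {G : Type*} [Group G] (S : Finset G) (g : G) : ℕ :=
  sInf {n : ℕ | ∃ w : List G, w.length = n ∧ (∀ x ∈ w, x ∈ S ∨ x⁻¹ ∈ S) ∧ w.prod = g}

/-! ### Random walks on groups -/

/-- The convolution `μ * ν`: the law of `x * y` for independent `x ∼ μ`, `y ∼ ν`. -/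
def PMF.conv {G : Type*} [Group G] (μ ν : PMF G) : PMF G :=
  μ.bind fun x => ν.map fun y => x * y

/-- The `n`-fold convolution power `μ^{*n}`, the law of the random walk after `n` steps. -/
def PMF.convPow {G : Type*} [Group G] (μ : PMF G) : ℕ → PMF G
  | 0 => PMF.pure 1
  | n + 1 => (PMF.convPow μ n).conv μ

/-- A probability measure on a group is symmetric if `μ(g⁻¹) = μ(g)` for all `g`. -/
def PMF.IsSymmetric {G : Type*} [Group G] (μ : PMF G) : Prop :=
  ∀ g : G, μ g⁻¹ = μ g

/-- The drift function `L(n) = ∑_g l_S(g) μ^{*n}(g)`. -/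
def drift {G : Type*} [Group G] (S : Finset G) (μ : PMF G) (n : ℕ) : ℝ :=
  ∑' g : G, (wordLength S g : ℝ) * (μ.convPow n g).toReal

/-! ### Individual almost invariance -/

/-- The walk `(G, μ)` has individually almost invariant distributions on the scale `r`:
for every `ε > 0` and every sequence `g_n` with `l_S(g_n) ≤ r(n)` there are sets `V_n` such that,
for all sufficiently large `n`, `μ^{*n}(V_n) ≥ 1 - ε` and
`|μ^{*n}(h g_n) / μ^{*n}(h) - 1| ≤ ε` for all `h ∈ V_n`. -/
def IndividuallyAlmostInvariant {G : Type*} [Group G] (S : Finset G) (μ : PMF G)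
    (r : ℕ → ℝ≥0) : Prop :=
  ∀ ε : ℝ, 0 < ε → ∀ g : ℕ → G, (∀ n, (wordLength S (g n) : ℝ≥0) ≤ r n) →
    ∃ V : ℕ → Set G, ∀ᶠ n in atTop,
      1 - ε ≤ ((μ.convPow n).toOuterMeasure (V n)).toReal ∧
      ∀ h ∈ V n, μ.convPow n h ≠ 0 ∧
        |(μ.convPow n (h * g n)).toReal / (μ.convPow n h).toReal - 1| ≤ ε

/-- `r̄ ≼ r`: the radius of individual almost invariance is asymptotically smaller than `r`, i.e.
for every `r'` such that `r'(n) / r(n)` tends to infinity on some subsequence, the walk is not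
individually almost invariant on the scale `r'`. -/
def IndividualRadiusPreceq {G : Type*} [Group G] (S : Finset G) (μ : PMF G)
    (r : ℕ → ℝ≥0) : Prop :=
  ∀ r' : ℕ → ℝ≥0,
    (∃ φ : ℕ → ℕ, StrictMono φ ∧ Tendsto (fun k => r' (φ k) / r (φ k)) atTop atTop) →
    ¬ IndividuallyAlmostInvariant S μ r'

/-! ### Wreath products -/

/-- The (restricted) wreath product of `A` with `B`, with `A` acting by shifts on the finitely
supported functions `A → B`, as a subgroup of the unrestricted one. -/
def wreathSubgroup (A B : Type*) [Group A] [Group B] :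
    Subgroup (RegularWreathProduct B A) where
  carrier := {w | (Function.mulSupport w.left).Finite}
  one_mem' := by simp
  mul_mem' := by
    intro v w hv hw
    have hw' : (Function.mulSupport fun x => w.left (v.right⁻¹ * x)).Finite :=
      Set.Finite.preimage (f := fun x => v.right⁻¹ * x) ((mul_right_injective _).injOn) hw
    exact (hv.union hw').subset (Function.mulSupport_mul _ _)
  inv_mem' := by
    intro w hw
    have h : (Function.mulSupport fun x => w.left (w.right * x)).Finite :=
      Set.Finite.preimage (f := fun x => w.right * x) ((mul_right_injective _).injOn) hw
    refine h.subset fun x hx => ?_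
    simpa [Function.mem_mulSupport] using hx

/-- The wreath product of `A` with `B` (`A` is the group that acts). -/
abbrev Wreath (A B : Type*) [Group A] [Group B] : Type _ := wreathSubgroup A B

open Classical in
/-- The switch `b ∈ B`, as the element of the wreath product with trivial `A`-component whose
configuration is `b` at the identity of `A` and trivial elsewhere. -/
def Wreath.switch (A : Type*) {B : Type*} [Group A] [Group B] (b : B) : Wreath A B :=
  ⟨⟨Pi.mulSingle 1 b, 1⟩,
    (Set.finite_singleton (1 : A)).subset Pi.mulSupport_mulSingle_subset⟩

/-- The element `a ∈ A` of the wreath product, with trivial configuration. -/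
def Wreath.walk {A : Type*} (B : Type*) [Group A] [Group B] (a : A) : Wreath A B :=
  ⟨⟨1, a⟩, by simp [wreathSubgroup]⟩

/-- The switch-walk-switch measure `μ_B * μ_A * μ_B` on the wreath product. -/
def switchWalkSwitch {A B : Type*} [Group A] [Group B] (μA : PMF A) (μB : PMF B) :
    PMF (Wreath A B) :=
  ((μB.map (Wreath.switch A)).conv (μA.map (Wreath.walk B))).conv (μB.map (Wreath.switch A))

/-- The `i` times iterated wreath product of `ℤ` with `H`: `G_0 = H`, `G_{i+1} = ℤ ≀ G_i`. -/
def IteratedWreath (H : Type u) [Group H] : ℕ → GrpCat.{u}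
  | 0 => GrpCat.of H
  | i + 1 => GrpCat.of (Wreath (Multiplicative ℤ) (IteratedWreath H i))

/-- The iterated switch-walk-switch measure: `μ_0` is the given measure on `H`, and
`μ_{i+1} = μ_i * ν_i * μ_i` on `G_{i+1} = ℤ ≀ G_i`, where `ν_i` is a measure on `ℤ`. -/
def iteratedSwitchWalkSwitch {H : Type u} [Group H] (ν : ℕ → PMF (Multiplicative ℤ))
    (μ : PMF H) : (i : ℕ) → PMF (IteratedWreath H i)
  | 0 => (μ : PMF H)
  | i + 1 => (switchWalkSwitch (ν i) (iteratedSwitchWalkSwitch ν μ i) :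
      PMF (Wreath (Multiplicative ℤ) (IteratedWreath H i)))

end

/-!
The final value of the lamp under the cursor is an observable of a switch-walk-switch walk on
`ℤ ≀ B` which is multiplied by `b` when the element is right-translated by the switch `b`. Given the
trajectory of the cursor, this lamp has performed one step of the walk on `B` for each switch at the
final position of the cursor (`expect_lamp_cursor`), and there are `O(√n)` such switches on average
(`exists_expect_switchCountLaw_fst_le`). Hence a quantity of order `n ^ p` for the walk on `B`
becomes one of order `n ^ (p / 2)` for the lamp (`exists_expect_lamp_le`). Starting from the drift
`√n` on `H` and iterating, one obtains an `H`-valued observable on `G_i` of mean length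
`O(n ^ (1 / 2 ^ (i + 1)))`, equivariant under the iterated switches `ι b`, `b ∈ H`.

If `b` is much longer than this, translation by `ι b` carries the elements whose observable has
moderate length to elements whose observable is unusually long. By Markov's inequality the latter
have small probability, so the law cannot be nearly invariant on a large set
(`individualRadiusPreceq_of_expect_le`). Such `b` of any prescribed length exist because the drift,
hence the word length on `H`, is unbounded.

The bound on the number of switches needs no local limit theorem. For a symmetric walk `Z` on `ℤ`
the absolute value is subharmonic, and its mean increment at the origin is the mean absolute step
`σ₁`; therefore `σ₁` times the expected number of visits to the origin is at most `E|Z_n|`, which is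
`O(√n)` since `E Z_n ^ 2` is linear in `n`.

If some step law on `ℤ` is the Dirac mass at the origin, the walk is confined to a proper subgroup,
and translation by a fixed element outside of it already destroys almost invariance
(`individualRadiusPreceq_of_support_subset`).
-/

/-! ### Expectations under discrete laws -/

namespace PMF

/-- The expectation of a `[0, ∞]`-valued function under a discrete law. -/
noncomputable def expect {α : Type*} (p : PMF α) (f : α → ℝ≥0∞) : ℝ≥0∞ := ∑' x, p x * f x

section Expect

variable {α β : Type*}

@[simp]
theorem expect_pure (a : α) (f : α → ℝ≥0∞) : (PMF.pure a).expect f = f a := by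
  classical
  rw [expect, tsum_eq_single a]
  · simp
  · intro b hb
    simp [PMF.pure_apply, hb]

theorem expect_bind (p : PMF α) (k : α → PMF β) (f : β → ℝ≥0∞) :
    (p.bind k).expect f = p.expect fun x => (k x).expect f := by
  simp only [expect, PMF.bind_apply, ← ENNReal.tsum_mul_right, ← ENNReal.tsum_mul_left]
  rw [ENNReal.tsum_comm]
  simp only [mul_assoc]

theorem expect_map (p : PMF α) (k : α → β) (f : β → ℝ≥0∞) :
    (p.map k).expect f = p.expect fun x => f (k x) := by
  rw [PMF.map, expect_bind]
  simp

theorem expect_comm (p : PMF α) (q : PMF β) (f : α → β → ℝ≥0∞) :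
    (p.expect fun x => q.expect fun y => f x y) = q.expect fun y => p.expect fun x => f x y := by
  simp only [expect, ← ENNReal.tsum_mul_left]
  rw [ENNReal.tsum_comm]
  simp only [mul_left_comm]

theorem expect_mono_of_support {p : PMF α} {f g : α → ℝ≥0∞} (h : ∀ x ∈ p.support, f x ≤ g x) :
    p.expect f ≤ p.expect g := by
  refine ENNReal.tsum_le_tsum fun x => ?_
  by_cases hx : p x = 0
  · simp [hx]
  · gcongr
    exact h x ((p.mem_support_iff x).2 hx)

theorem expect_mono {p : PMF α} {f g : α → ℝ≥0∞} (h : ∀ x, f x ≤ g x) :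
    p.expect f ≤ p.expect g :=
  expect_mono_of_support fun x _ => h x

theorem expect_add (p : PMF α) (f g : α → ℝ≥0∞) :
    (p.expect fun x => f x + g x) = p.expect f + p.expect g := by
  simp only [expect, mul_add, ENNReal.tsum_add]

theorem expect_const_mul (p : PMF α) (c : ℝ≥0∞) (f : α → ℝ≥0∞) :
    (p.expect fun x => c * f x) = c * p.expect f := by
  simp only [expect, ← ENNReal.tsum_mul_left, mul_left_comm]

@[simp]
theorem expect_const (p : PMF α) (c : ℝ≥0∞) : (p.expect fun _ => c) = c := by
  simp [expect, ENNReal.tsum_mul_right, p.tsum_coe]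

theorem expect_ne_top {p : PMF α} (hp : p.support.Finite) {f : α → ℝ≥0∞} (hf : ∀ x, f x ≠ ∞) :
    p.expect f ≠ ∞ := by
  obtain ⟨M, hM⟩ : ∃ M : ℝ≥0, ∀ x ∈ p.support, f x ≤ M := by
    refine ⟨∑ x ∈ hp.toFinset, (f x).toNNReal, fun x hx => ?_⟩
    rw [← ENNReal.coe_toNNReal (hf x)]
    exact_mod_cast Finset.single_le_sum (f := fun x => (f x).toNNReal) (fun _ _ => zero_le)
      (hp.mem_toFinset.2 hx)
  refine ne_top_of_le_ne_top (ENNReal.coe_ne_top (r := M)) ?_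
  simpa using expect_mono_of_support (g := fun _ => (M : ℝ≥0∞)) hM

/-- Markov's inequality. -/
theorem mul_toOuterMeasure_le_expect (p : PMF α) {f : α → ℝ≥0∞} {c : ℝ≥0∞} {s : Set α}
    (h : ∀ x ∈ s, c ≤ f x) : c * p.toOuterMeasure s ≤ p.expect f := by
  rw [PMF.toOuterMeasure_apply, ← ENNReal.tsum_mul_left]
  refine ENNReal.tsum_le_tsum fun x => ?_
  by_cases hx : x ∈ s
  · rw [Set.indicator_of_mem hx, mul_comm]
    gcongr
    exact h x hx
  · simp [hx]

end Expect

section Conv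

variable {G : Type*} [Group G]

theorem expect_conv (μ ν : PMF G) (f : G → ℝ≥0∞) :
    (μ.conv ν).expect f = μ.expect fun x => ν.expect fun y => f (x * y) := by
  simp only [conv, expect_bind, expect_map]

@[simp]
theorem expect_convPow_zero (μ : PMF G) (f : G → ℝ≥0∞) : (μ.convPow 0).expect f = f 1 := by
  simp [convPow]

theorem expect_convPow_succ (μ : PMF G) (n : ℕ) (f : G → ℝ≥0∞) :
    (μ.convPow (n + 1)).expect f = (μ.convPow n).expect fun x => μ.expect fun y => f (x * y) :=
  expect_conv _ _ _

/-- The walk seen from its first step rather than from its last one. -/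
theorem expect_convPow_succ' (μ : PMF G) (n : ℕ) (f : G → ℝ≥0∞) :
    (μ.convPow (n + 1)).expect f = μ.expect fun x => (μ.convPow n).expect fun y => f (x * y) := by
  induction n generalizing f with
  | zero => simp [expect_convPow_succ]
  | succ n ih =>
    rw [expect_convPow_succ, ih]
    simp only [expect_convPow_succ, mul_assoc]

theorem support_conv_subset {μ ν : PMF G} {K : Subgroup G} (hμ : μ.support ⊆ K)
    (hν : ν.support ⊆ K) : (μ.conv ν).support ⊆ K := by
  intro g hg
  simp only [conv, PMF.mem_support_bind_iff, PMF.mem_support_map_iff] at hg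
  obtain ⟨x, hx, y, hy, rfl⟩ := hg
  exact K.mul_mem (hμ hx) (hν hy)

theorem support_convPow_subset {μ : PMF G} {K : Subgroup G} (hμ : μ.support ⊆ K) (n : ℕ) :
    (μ.convPow n).support ⊆ K := by
  induction n with
  | zero => simp [convPow, K.one_mem]
  | succ n ih => exact support_conv_subset ih hμ

end Conv

end PMF

/-! ### Word length -/

section WordLength

variable {G : Type*} [Group G] {S : Finset G}

theorem wordLength_prod_le {w : List G} (hw : ∀ x ∈ w, x ∈ S ∨ x⁻¹ ∈ S) :
    wordLength S w.prod ≤ w.length :=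
  Nat.sInf_le ⟨w, rfl, hw, rfl⟩

theorem exists_word_of_closure_eq_top (hS : Subgroup.closure (S : Set G) = ⊤) (g : G) :
    ∃ w : List G, w.length = wordLength S g ∧ (∀ x ∈ w, x ∈ S ∨ x⁻¹ ∈ S) ∧ w.prod = g := by
  have hg : g ∈ (Subgroup.closure (S : Set G)).toSubmonoid := by simp [hS]
  rw [Subgroup.closure_toSubmonoid] at hg
  obtain ⟨w, hw, hwg⟩ := Submonoid.exists_list_of_mem_closure hg
  exact Nat.sInf_mem (s := {n : ℕ | ∃ w : List G, w.length = n ∧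
    (∀ x ∈ w, x ∈ S ∨ x⁻¹ ∈ S) ∧ w.prod = g}) ⟨_, w, rfl, fun x hx => by simpa using hw x hx, hwg⟩

@[simp]
theorem wordLength_one : wordLength S (1 : G) = 0 :=
  Nat.le_zero.1 (wordLength_prod_le (w := []) (by simp))

theorem wordLength_mul_le (hS : Subgroup.closure (S : Set G) = ⊤) (g h : G) :
    wordLength S (g * h) ≤ wordLength S g + wordLength S h := by
  obtain ⟨v, hv, hvS, rfl⟩ := exists_word_of_closure_eq_top hS g
  obtain ⟨w, hw, hwS, rfl⟩ := exists_word_of_closure_eq_top hS h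
  rw [← hv, ← hw, ← List.length_append, ← List.prod_append]
  exact wordLength_prod_le fun x hx => (List.mem_append.1 hx).elim (hvS x) (hwS x)

theorem wordLength_inv_le (hS : Subgroup.closure (S : Set G) = ⊤) (g : G) :
    wordLength S g⁻¹ ≤ wordLength S g := by
  obtain ⟨w, hw, hwS, rfl⟩ := exists_word_of_closure_eq_top hS g
  rw [← hw, List.prod_inv_reverse]
  refine (wordLength_prod_le fun x hx => ?_).trans (by simp)
  simp only [List.mem_reverse, List.mem_map] at hx
  obtain ⟨y, hy, rfl⟩ := hx
  simpa using (hwS y hy).symm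

/-- A prefix of a geodesic word is geodesic, so the lengths of elements have no gaps. -/
theorem exists_wordLength_eq (hS : Subgroup.closure (S : Set G) = ⊤) {m : ℕ} {g : G}
    (hg : m ≤ wordLength S g) : ∃ h : G, wordLength S h = m := by
  obtain ⟨w, hw, hwS, rfl⟩ := exists_word_of_closure_eq_top hS g
  have htake : wordLength S (w.take m).prod ≤ (w.take m).length :=
    wordLength_prod_le fun x hx => hwS x (List.mem_of_mem_take hx)
  have hdrop : wordLength S (w.drop m).prod ≤ (w.drop m).length :=
    wordLength_prod_le fun x hx => hwS x (List.mem_of_mem_drop hx)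
  have hmul := wordLength_mul_le hS (w.take m).prod (w.drop m).prod
  rw [List.prod_take_mul_prod_drop] at hmul
  simp only [List.length_take, List.length_drop] at htake hdrop
  exact ⟨(w.take m).prod, by omega⟩

/-- Homomorphisms between finitely generated groups are Lipschitz for the word lengths. -/
theorem exists_wordLength_map_le {H : Type*} [Group H] {T : Finset H}
    (hS : Subgroup.closure (S : Set G) = ⊤) (hT : Subgroup.closure (T : Set H) = ⊤)
    (f : G →* H) : ∃ D : ℕ, 1 ≤ D ∧ ∀ g, wordLength T (f g) ≤ D * wordLength S g := by
  refine ⟨S.sup (fun s => wordLength T (f s)) + 1, by omega, fun g => ?_⟩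
  obtain ⟨w, hw, hwS, rfl⟩ := exists_word_of_closure_eq_top hS g
  rw [← hw]
  clear hw
  induction w with
  | nil => simp
  | cons x w ih =>
    have hx : wordLength T (f x) ≤ S.sup fun s => wordLength T (f s) := by
      rcases hwS x (by simp) with h | h
      · exact Finset.le_sup (f := fun s => wordLength T (f s)) h
      · refine le_trans ?_ (Finset.le_sup (f := fun s => wordLength T (f s)) h)
        simpa using wordLength_inv_le hT (f x⁻¹)
    have ih' := ih fun y hy => hwS y (by simp [hy])
    have := wordLength_mul_le hT (f x) (f w.prod)
    rw [List.prod_cons, map_mul, List.length_cons, mul_add_one]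
    omega

/-- The mean word length grows at most linearly. -/
theorem expect_wordLength_convPow_le (hS : Subgroup.closure (S : Set G) = ⊤) (μ : PMF G) (n : ℕ) :
    ((μ.convPow n).expect fun g => (wordLength S g : ℝ≥0∞))
      ≤ n * μ.expect fun g => (wordLength S g : ℝ≥0∞) := by
  induction n with
  | zero => simp
  | succ n ih =>
    rw [PMF.expect_convPow_succ, Nat.cast_add_one, add_mul, one_mul]
    calc _ ≤ (μ.convPow n).expect fun x => μ.expect fun y =>
          (wordLength S x : ℝ≥0∞) + wordLength S y :=
        PMF.expect_mono fun x => PMF.expect_mono fun y => by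
          exact_mod_cast wordLength_mul_le hS x y
      _ ≤ _ := by
        simp only [PMF.expect_add, PMF.expect_const]
        gcongr

theorem drift_eq_toReal_expect (S : Finset G) (μ : PMF G) (n : ℕ) :
    drift S μ n = ((μ.convPow n).expect fun g => (wordLength S g : ℝ≥0∞)).toReal := by
  rw [drift, PMF.expect, ENNReal.tsum_toReal_eq fun g =>
    ENNReal.mul_ne_top ((μ.convPow n).apply_ne_top g) (ENNReal.natCast_ne_top _)]
  simp [mul_comm]

end WordLength

/-! ### Obstructions to individual almost invariance -/

section Obstruction

variable {G : Type*} [Group G]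

/-- If right translation by `g` moves `V \ A` into `A` and at most halves the mass of its points,
then the mass of `V` is controlled by the mass of `A`. -/
theorem PMF.toOuterMeasure_le_three_mul (q : PMF G) {V A : Set G} {g : G}
    (h : ∀ x ∈ V, x ∉ A → q x ≤ 2 * q (x * g) ∧ x * g ∈ A) :
    q.toOuterMeasure V ≤ 3 * q.toOuterMeasure A := by
  simp only [PMF.toOuterMeasure_apply]
  have htrans : ∑' x, A.indicator q (x * g) = ∑' x, A.indicator q x :=
    (Equiv.mulRight g).tsum_eq (A.indicator q)
  calc ∑' x, V.indicator q x ≤ ∑' x, (A.indicator q x + 2 * A.indicator q (x * g)) := by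
        refine ENNReal.tsum_le_tsum fun x => ?_
        by_cases hV : x ∈ V
        · by_cases hA : x ∈ A
          · simp [hV, hA]
          · simp [hV, hA, (h x hV hA).2, (h x hV hA).1]
        · simp [hV]
    _ = 3 * ∑' x, A.indicator q x := by
        rw [ENNReal.tsum_add, ENNReal.tsum_mul_left, htrans]
        ring

/-- A walk that stays in a proper subgroup is not almost invariant under an element outside of
it. -/
theorem individualRadiusPreceq_of_support_subset (T : Finset G) {ρ : PMF G} {K : Subgroup G}
    (hK : K ≠ ⊤) (hρ : ρ.support ⊆ K) {r : ℕ → ℝ≥0} (hr : ∀ n, 1 ≤ n → 1 ≤ r n) :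
    IndividualRadiusPreceq T ρ r := by
  rintro r' ⟨φ, hφ, hlim⟩ hinv
  obtain ⟨t, ht⟩ : ∃ t, t ∉ K := by
    by_contra! h
    exact hK (eq_top_iff.2 fun x _ => h x)
  classical
  obtain ⟨V, hV⟩ := hinv (1 / 4) (by norm_num)
    (fun n => if (wordLength T t : ℝ≥0) ≤ r' n then t else 1) (fun n => by
      split_ifs with h
      · exact h
      · simp)
  obtain ⟨k, ⟨hmass, hk⟩, hlen, hk1⟩ := ((hφ.tendsto_atTop.eventually hV).and
    ((hlim.eventually_ge_atTop (wordLength T t : ℝ≥0)).and (eventually_ge_atTop 1))).exists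
  have hr1 : 1 ≤ r (φ k) := hr _ (hk1.trans (hφ.id_le k))
  have hlen' : (wordLength T t : ℝ≥0) ≤ r' (φ k) := by
    rw [le_div_iff₀ (by positivity)] at hlen
    exact (le_mul_of_one_le_right (by positivity) hr1).trans hlen
  obtain ⟨h, hh⟩ : (V (φ k)).Nonempty := by
    by_contra hne
    rw [Set.not_nonempty_iff_eq_empty.1 hne] at hmass
    norm_num at hmass
  obtain ⟨hne, hle⟩ := hk h hh
  rw [if_pos hlen'] at hle
  have hsupp := PMF.support_convPow_subset hρ (φ k)
  have hhK : h ∈ K := hsupp ((PMF.mem_support_iff _ _).2 hne)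
  have hzero : ρ.convPow (φ k) (h * t) = 0 := by
    by_contra h0
    exact ht ((K.mul_mem_cancel_left hhK).1 (hsupp ((PMF.mem_support_iff _ _).2 h0)))
  rw [hzero] at hle
  norm_num at hle

/-- If an `H`-valued observable of the walk has mean length at most `C * r n` and is
right-equivariant under an embedded copy of `H`, then translation by embedded elements much longer
than `r n` visibly changes its law. -/
theorem individualRadiusPreceq_of_expect_le {H : Type*} [Group H] {S : Finset H} {T : Finset G}
    (hS : Subgroup.closure (S : Set H) = ⊤) (hT : Subgroup.closure (T : Set G) = ⊤)
    (hunb : ∀ m : ℕ, ∃ b : H, m ≤ wordLength S b) {ρ : PMF G} (ι : H →* G) (obs : G → H)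
    (hobs : ∀ g b, obs (g * ι b) = obs g * b) {C : ℝ≥0} {r : ℕ → ℝ≥0}
    (hr : ∀ n, 1 ≤ n → 1 ≤ r n)
    (hC : ∀ n, ((ρ.convPow n).expect fun g => (wordLength S (obs g) : ℝ≥0∞)) ≤ C * r n) :
    IndividualRadiusPreceq T ρ r := by
  rintro r' ⟨φ, hφ, hlim⟩ hinv
  obtain ⟨D, hD1, hD⟩ := exists_wordLength_map_le hS hT ι
  have hD0 : (0 : ℝ≥0) < D := by exact_mod_cast hD1
  have hex : ∀ m : ℕ, ∃ b : H, wordLength S b = m := fun m =>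
    exists_wordLength_eq hS (hunb m).choose_spec
  choose b hb using hex
  obtain ⟨V, hV⟩ := hinv (1 / 4) (by norm_num) (fun n => ι (b ⌊r' n / D⌋₊)) (fun n => by
    calc (wordLength T (ι (b ⌊r' n / D⌋₊)) : ℝ≥0) ≤ D * (⌊r' n / D⌋₊ : ℝ≥0) := by
          exact_mod_cast (hD _).trans_eq (by rw [hb])
      _ ≤ D * (r' n / D) := by gcongr; exact Nat.floor_le (by positivity)
      _ = r' n := mul_div_cancel₀ _ hD0.ne')
  -- The threshold makes the length of `b` at least `(16 * C + 16) * r n` after rounding down, so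
  -- that by Markov's inequality the set `A` below has mass at most `1 / 8`.
  obtain ⟨k, ⟨hmass, hk⟩, hlen, hk1⟩ := ((hφ.tendsto_atTop.eventually hV).and
    ((hlim.eventually_ge_atTop (D * (16 * C + 17) : ℝ≥0)).and (eventually_ge_atTop 1))).exists
  set n := φ k with hn
  have hr1 : 1 ≤ r n := hr _ (hk1.trans (hφ.id_le k))
  set m := ⌊r' n / D⌋₊ with hm
  have hmr : (16 * C + 16) * r n ≤ (m : ℝ≥0) := by
    rw [le_div_iff₀ (by positivity), mul_assoc, mul_comm (D : ℝ≥0), ← le_div_iff₀ hD0] at hlen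
    have hfloor : r' n / D < m + 1 := Nat.lt_floor_add_one _
    have h1 : (16 * C + 16) * r n + 1 ≤ (m : ℝ≥0) + 1 := by
      refine le_trans ?_ (hlen.trans hfloor.le)
      calc (16 * C + 16) * r n + 1 ≤ (16 * C + 16) * r n + r n := by gcongr
        _ = (16 * C + 17) * r n := by ring
    exact le_of_add_le_add_right h1
  set q := ρ.convPow n
  -- If the observable of `x` is shorter than `m / 2`, that of `x * ι b` is longer than `m / 2`.
  let A : Set G := {g | m ≤ 2 * wordLength S (obs g)}
  have hA : (8 : ℝ≥0∞) * q.toOuterMeasure A ≤ 1 := by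
    have hmarkov : (m : ℝ≥0∞) * q.toOuterMeasure A ≤ 2 * (C * r n) := by
      refine (q.mul_toOuterMeasure_le_expect
        (f := fun g => 2 * (wordLength S (obs g) : ℝ≥0∞)) fun g hg => ?_).trans ?_
      · exact_mod_cast hg
      · rw [PMF.expect_const_mul]
        gcongr
        exact hC n
    have hx : (2 * (C + 1) * r n : ℝ≥0∞) ≠ 0 := by
      have : (r n : ℝ≥0∞) ≠ 0 := by exact_mod_cast (zero_lt_one.trans_le hr1).ne'
      simp [this]
    have hx' : (2 * (C + 1) * r n : ℝ≥0∞) ≠ ∞ := by finiteness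
    refine (ENNReal.mul_le_mul_iff_right hx hx').1 ?_
    calc (2 * (C + 1) * r n : ℝ≥0∞) * (8 * q.toOuterMeasure A)
        = ((16 * C + 16) * r n : ℝ≥0∞) * q.toOuterMeasure A := by ring
      _ ≤ (m : ℝ≥0∞) * q.toOuterMeasure A := by
          gcongr
          exact_mod_cast hmr
      _ ≤ 2 * (C * r n) := hmarkov
      _ ≤ 2 * ((C + 1) * r n) := by gcongr; exact le_self_add
      _ = (2 * (C + 1) * r n : ℝ≥0∞) * 1 := by ring
  have hVA : q.toOuterMeasure (V n) ≤ 3 * q.toOuterMeasure A := by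
    refine q.toOuterMeasure_le_three_mul (g := ι (b m)) fun x hx hxA => ⟨?_, ?_⟩
    · obtain ⟨hne, hle⟩ := hk x hx
      have hpos : 0 < (q x).toReal := ENNReal.toReal_pos hne (q.apply_ne_top x)
      have hlow := (abs_le.1 hle).1
      have hratio : 3 / 4 ≤ (q (x * ι (b m))).toReal / (q x).toReal := by linarith
      rw [le_div_iff₀ hpos] at hratio
      rw [← ENNReal.toReal_le_toReal (q.apply_ne_top x)
        (ENNReal.mul_ne_top (by simp) (q.apply_ne_top _)), ENNReal.toReal_mul]
      simp only [ENNReal.toReal_ofNat]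
      linarith
    · have hmul := wordLength_mul_le hS (obs x)⁻¹ (obs x * b m)
      have hinv' := wordLength_inv_le hS (obs x)
      rw [inv_mul_cancel_left, hb] at hmul
      simp only [A, Set.mem_ofPred_eq, hobs] at hxA ⊢
      omega
  have hsmall : q.toOuterMeasure (V n) ≤ 3 / 8 := by
    refine hVA.trans ?_
    rw [ENNReal.le_div_iff_mul_le (by simp) (by simp)]
    calc 3 * q.toOuterMeasure A * 8 = 3 * (8 * q.toOuterMeasure A) := by ring
      _ ≤ 3 * 1 := by gcongr
      _ = 3 := by simp
  have hreal : (q.toOuterMeasure (V n)).toReal ≤ 3 / 8 := by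
    have := ENNReal.toReal_mono (by finiteness) hsmall
    simpa using this
  linarith

end Obstruction

/-! ### The lamp at the cursor of a switch-walk-switch walk -/

namespace Wreath

variable {A B : Type*} [Group A] [Group B]

/-- The position of the cursor. -/
def cursor (w : Wreath A B) : A := w.1.right

/-- The value of the configuration at the position of the cursor. -/
def lamp (w : Wreath A B) : B := w.1.left w.1.right

/-- The switches, as an embedding of the lamp group. -/
noncomputable def switchHom (A B : Type*) [Group A] [Group B] : B →* Wreath A B where
  toFun := Wreath.switch A
  map_one' := by
    apply Subtype.ext
    ext x <;> simp [Wreath.switch]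
  map_mul' b c := by
    apply Subtype.ext
    ext x
    · simp [Wreath.switch, Pi.mulSingle_mul]
    · simp [Wreath.switch]

@[simp]
theorem lamp_one : lamp (1 : Wreath A B) = 1 := rfl

@[simp]
theorem cursor_one : cursor (1 : Wreath A B) = 1 := rfl

theorem lamp_mul_switchHom (w : Wreath A B) (b : B) :
    lamp (w * switchHom A B b) = lamp w * b := by
  simp [lamp, switchHom, Wreath.switch]

theorem cursor_switch_walk_switch_mul (b b' : B) (z : A) (w : Wreath A B) :
    cursor (switch A b * walk B z * switch A b' * w) = z * cursor w := by
  simp [cursor, switch, walk]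

open Classical in
/-- A step performed before `w` contributes to the final lamp exactly through those of its two
switches that happen at the final position of the cursor. -/
theorem lamp_switch_walk_switch_mul (b b' : B) (z : A) (w : Wreath A B) :
    lamp (switch A b * walk B z * switch A b' * w) =
      (if z * cursor w = 1 then b else 1) * ((if cursor w = 1 then b' else 1) * lamp w) := by
  simp only [lamp, cursor, switch, walk, Pi.mulSingle_apply, Subgroup.coe_mul,
    RegularWreathProduct.mul_left, RegularWreathProduct.mul_right, Pi.mul_apply, Pi.one_apply,
    one_mul, inv_one, inv_mul_cancel_left, mul_assoc]
  congr

/-- The elements of the wreath product all of whose lamps lie in a given subgroup. -/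
def lampSubgroup (A : Type*) {B : Type*} [Group A] [Group B] (K : Subgroup B) :
    Subgroup (Wreath A B) where
  carrier := {w | ∀ x, w.1.left x ∈ K}
  one_mem' _ := K.one_mem
  mul_mem' hv hw x := K.mul_mem (hv x) (hw _)
  inv_mem' hw _ := K.inv_mem (hw _)

theorem lampSubgroup_ne_top {K : Subgroup B} (hK : K ≠ ⊤) : lampSubgroup A K ≠ ⊤ := by
  intro h
  refine hK (eq_top_iff.2 fun b _ => ?_)
  have hb : switch A b ∈ lampSubgroup A K := h ▸ Subgroup.mem_top _
  simpa [switch] using hb 1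

/-- The projection to the cursor position, as a homomorphism. -/
def cursorHom (A B : Type*) [Group A] [Group B] : Wreath A B →* A where
  toFun := cursor
  map_one' := rfl
  map_mul' _ _ := rfl

theorem ker_cursorHom_ne_top [Nontrivial A] : (cursorHom A B).ker ≠ ⊤ := by
  intro h
  obtain ⟨a, ha⟩ := exists_ne (1 : A)
  have hw : walk B a ∈ (cursorHom A B).ker := h ▸ Subgroup.mem_top _
  exact ha hw

end Wreath

section SwitchWalkSwitch

variable {A B : Type*} [Group A] [Group B]

theorem expect_switchWalkSwitch (ν : PMF A) (ρ : PMF B) (f : Wreath A B → ℝ≥0∞) :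
    (switchWalkSwitch ν ρ).expect f = ρ.expect fun b => ν.expect fun z => ρ.expect fun b' =>
      f (Wreath.switch A b * Wreath.walk B z * Wreath.switch A b') := by
  simp only [switchWalkSwitch, PMF.expect_conv, PMF.expect_map]

theorem mem_support_switchWalkSwitch {ν : PMF A} {ρ : PMF B} {w : Wreath A B}
    (hw : w ∈ (switchWalkSwitch ν ρ).support) : ∃ b ∈ ρ.support, ∃ z ∈ ν.support,
      ∃ b' ∈ ρ.support, Wreath.switch A b * Wreath.walk B z * Wreath.switch A b' = w := by
  simp only [switchWalkSwitch, PMF.conv, PMF.mem_support_bind_iff, PMF.mem_support_map_iff] at hw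
  obtain ⟨_, ⟨_, ⟨b, hb, rfl⟩, _, ⟨z, hz, rfl⟩, rfl⟩, _, ⟨b', hb', rfl⟩, rfl⟩ := hw
  exact ⟨b, hb, z, hz, b', hb', rfl⟩

theorem support_switchWalkSwitch_subset_lampSubgroup (ν : PMF A) {ρ : PMF B} {K : Subgroup B}
    (hρ : ρ.support ⊆ K) : (switchWalkSwitch ν ρ).support ⊆ Wreath.lampSubgroup A K := by
  classical
  intro w hw
  obtain ⟨b, hb, z, -, b', hb', rfl⟩ := mem_support_switchWalkSwitch hw
  have hswitch : ∀ c ∈ ρ.support, Wreath.switch A c ∈ Wreath.lampSubgroup A K := by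
    intro c hc x
    simp only [Wreath.switch, Pi.mulSingle_apply]
    split_ifs
    exacts [hρ hc, K.one_mem]
  exact mul_mem (mul_mem (hswitch b hb) fun _ => K.one_mem) (hswitch b' hb')

theorem support_switchWalkSwitch_subset_ker_cursorHom {ν : PMF A} (hν : ν.support ⊆ {1})
    (ρ : PMF B) : (switchWalkSwitch ν ρ).support ⊆ (Wreath.cursorHom A B).ker := by
  intro w hw
  obtain ⟨b, -, z, hz, b', -, rfl⟩ := mem_support_switchWalkSwitch hw
  obtain rfl := hν hz
  change (1 : A) * 1 * 1 = 1
  simp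

open Classical in
/-- The joint law of the number of switches performed at the final position of the cursor and of
that position, after `n` steps of a switch-walk-switch walk whose cursor moves by `ν`. It is
generated backwards in time: a new step is inserted before all the previous ones, which makes the
pair a Markov chain. -/
noncomputable def switchCountLaw (ν : PMF A) : ℕ → PMF (ℕ × A)
  | 0 => PMF.pure (0, 1)
  | n + 1 => (switchCountLaw ν n).bind fun q => ν.map fun z =>
      (q.1 + (if q.2 = 1 then 1 else 0) + (if z * q.2 = 1 then 1 else 0), z * q.2)

open Classical in
theorem expect_switchCountLaw_succ (ν : PMF A) (n : ℕ) (f : ℕ × A → ℝ≥0∞) :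
    (switchCountLaw ν (n + 1)).expect f = (switchCountLaw ν n).expect fun q => ν.expect fun z =>
      f (q.1 + (if q.2 = 1 then 1 else 0) + (if z * q.2 = 1 then 1 else 0), z * q.2) := by
  simp only [switchCountLaw, PMF.expect_bind, PMF.expect_map]

theorem expect_switchCountLaw_snd (ν : PMF A) (n : ℕ) (f : A → ℝ≥0∞) :
    ((switchCountLaw ν n).expect fun q => f q.2) = (ν.convPow n).expect f := by
  induction n generalizing f with
  | zero => simp [switchCountLaw]
  | succ n ih =>
    rw [expect_switchCountLaw_succ, PMF.expect_convPow_succ', PMF.expect_comm,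
      PMF.expect_comm]
    rw [ih fun a => ν.expect fun z => f (z * a), PMF.expect_comm]

theorem PMF.expect_expect_convPow_ite (ρ : PMF B) (m : ℕ) (P : Prop) [Decidable P]
    (f : B → ℝ≥0∞) :
    (ρ.expect fun b => (ρ.convPow m).expect fun w => f ((if P then b else 1) * w)) =
      (ρ.convPow (m + if P then 1 else 0)).expect f := by
  split_ifs
  · rw [PMF.expect_convPow_succ']
  · simp

/-- Given the trajectory of the cursor, the lamp at its final position has performed one step of
the walk on `B` for each switch at that position. -/
theorem expect_lamp_cursor (ν : PMF A) (ρ : PMF B) (n : ℕ) (f : B → A → ℝ≥0∞) :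
    (((switchWalkSwitch ν ρ).convPow n).expect fun w => f w.lamp w.cursor) =
      (switchCountLaw ν n).expect fun q => (ρ.convPow q.1).expect fun b => f b q.2 := by
  classical
  induction n generalizing f with
  | zero => simp [switchCountLaw]
  | succ n ih =>
    rw [PMF.expect_convPow_succ', expect_switchWalkSwitch, expect_switchCountLaw_succ]
    simp only [Wreath.lamp_switch_walk_switch_mul, Wreath.cursor_switch_walk_switch_mul]
    calc _ = ρ.expect fun b => ν.expect fun z => ρ.expect fun b' =>
          (switchCountLaw ν n).expect fun q => (ρ.convPow q.1).expect fun w =>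
            f ((if z * q.2 = 1 then b else 1) * ((if q.2 = 1 then b' else 1) * w)) (z * q.2) := by
          congr! 6 with b z b'
          exact ih fun w a =>
            f ((if z * a = 1 then b else 1) * ((if a = 1 then b' else 1) * w)) (z * a)
      _ = (switchCountLaw ν n).expect fun q => ν.expect fun z => ρ.expect fun b =>
            ρ.expect fun b' => (ρ.convPow q.1).expect fun w =>
            f ((if z * q.2 = 1 then b else 1) * ((if q.2 = 1 then b' else 1) * w)) (z * q.2) := by
          simp only [PMF.expect_comm ρ (switchCountLaw ν n), PMF.expect_comm ν (switchCountLaw ν n),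
            PMF.expect_comm ρ ν]
      _ = _ := by
          congr! 4 with q z
          refine Eq.trans ?_ (PMF.expect_expect_convPow_ite ρ _ _ fun w => f w (z * q.2))
          congr 1
          funext b
          exact PMF.expect_expect_convPow_ite ρ q.1 (q.2 = 1)
            fun w => f ((if z * q.2 = 1 then b else 1) * w) (z * q.2)

end SwitchWalkSwitch

/-! ### Returns of a symmetric walk on the integers -/

section IntegerWalk

/-- The absolute value of an integer, for the multiplicative copy of `ℤ`. -/
def zlen (x : Multiplicative ℤ) : ℕ := x.toAdd.natAbs

@[simp]
theorem zlen_one : zlen 1 = 0 := rfl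

theorem zlen_ne_zero {x : Multiplicative ℤ} (hx : x ≠ 1) : zlen x ≠ 0 := by
  simpa [zlen] using hx

open Classical in
theorem two_mul_zlen_add_le (x z : Multiplicative ℤ) :
    2 * zlen x + 2 * ((if x = 1 then 1 else 0) * zlen z) ≤ zlen (x * z) + zlen (x * z⁻¹) := by
  split_ifs with h
  · subst h
    simp only [zlen, toAdd_mul, toAdd_inv, toAdd_one]
    omega
  · simp only [zlen, toAdd_mul, toAdd_inv]
    omega

theorem zlen_mul_sq_add (x z : Multiplicative ℤ) :
    zlen (x * z) ^ 2 + zlen (x * z⁻¹) ^ 2 = 2 * zlen x ^ 2 + 2 * zlen z ^ 2 := by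
  simp only [zlen, toAdd_mul, toAdd_inv]
  zify
  simp only [sq_abs]
  ring

theorem PMF.IsSymmetric.expect_inv {G : Type*} [Group G] {ν : PMF G} (hν : ν.IsSymmetric)
    (f : G → ℝ≥0∞) : (ν.expect fun z => f z⁻¹) = ν.expect f := by
  rw [PMF.expect, PMF.expect, ← (Equiv.inv G).tsum_eq fun x => ν x * f x]
  simp only [Equiv.inv_apply, hν _]

/-- An expectation over a symmetric step can be computed from averages over opposite steps. -/
theorem PMF.IsSymmetric.two_mul_expect {G : Type*} [Group G] {ν : PMF G} (hν : ν.IsSymmetric)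
    (f : G → ℝ≥0∞) : 2 * ν.expect f = ν.expect fun z => f z + f z⁻¹ := by
  rw [PMF.expect_add, hν.expect_inv, two_mul]

variable {ν : PMF (Multiplicative ℤ)}

open Classical in
/-- The absolute value is subharmonic for a symmetric walk on `ℤ`, and its mean increment at the
origin is the mean absolute step: hence the visits to the origin are paid for by the growth of the
mean absolute position. -/
theorem expect_zlen_add_le (hν : ν.IsSymmetric) (n : ℕ) :
    ((ν.convPow n).expect fun x => (zlen x : ℝ≥0∞)) +
        (ν.expect fun z => (zlen z : ℝ≥0∞)) *
          ((ν.convPow n).expect fun x => if x = 1 then 1 else 0) ≤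
      (ν.convPow (n + 1)).expect fun x => (zlen x : ℝ≥0∞) := by
  rw [PMF.expect_convPow_succ, ← PMF.expect_const_mul, ← PMF.expect_add]
  refine PMF.expect_mono fun x => ?_
  refine (ENNReal.mul_le_mul_iff_right (a := 2) (by simp) (by simp)).1 ?_
  rw [hν.two_mul_expect]
  calc _ = ν.expect fun z => (2 * zlen x + 2 * ((if x = 1 then 1 else 0) * zlen z) : ℝ≥0∞) := by
        simp only [PMF.expect_add, PMF.expect_const_mul, PMF.expect_const]
        ring
    _ ≤ _ := PMF.expect_mono fun z => by
        have := two_mul_zlen_add_le x z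
        split_ifs at this ⊢ <;> exact_mod_cast this

theorem expect_zlen_sq (hν : ν.IsSymmetric) (n : ℕ) :
    ((ν.convPow n).expect fun x => (zlen x ^ 2 : ℝ≥0∞)) =
      n * ν.expect fun z => (zlen z ^ 2 : ℝ≥0∞) := by
  induction n with
  | zero => simp
  | succ n ih =>
    have hstep : ∀ x, (ν.expect fun z => (zlen (x * z) ^ 2 : ℝ≥0∞)) =
        zlen x ^ 2 + ν.expect fun z => (zlen z ^ 2 : ℝ≥0∞) := by
      intro x
      refine (ENNReal.mul_right_inj (a := 2) (by simp) (by simp)).1 ?_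
      rw [hν.two_mul_expect]
      calc _ = ν.expect fun z => (2 * zlen x ^ 2 + 2 * zlen z ^ 2 : ℝ≥0∞) := by
            congr 1
            funext z
            exact_mod_cast zlen_mul_sq_add x z
        _ = _ := by
            simp only [PMF.expect_add, PMF.expect_const_mul, PMF.expect_const]
            ring
    rw [PMF.expect_convPow_succ]
    simp only [hstep, PMF.expect_add, PMF.expect_const, ih]
    push_cast
    ring

theorem expect_zlen_le (hν : ν.IsSymmetric) (n : ℕ) :
    ((ν.convPow n).expect fun x => (zlen x : ℝ≥0∞)) ≤
      ((ν.expect fun z => (zlen z ^ 2 : ℝ≥0∞)) + 1) * NNReal.sqrt n := by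
  rcases Nat.eq_zero_or_pos n with rfl | hn
  · simp
  set s := NNReal.sqrt n with hs
  have hs0 : (s : ℝ≥0∞) ≠ 0 := by simpa [hs] using hn.ne'
  have hss : (s : ℝ≥0∞) * s = n := by exact_mod_cast NNReal.mul_self_sqrt (n : ℝ≥0)
  refine (ENNReal.mul_le_mul_iff_right hs0 ENNReal.coe_ne_top).1 ?_
  calc _ = (ν.convPow n).expect fun x => (s * zlen x : ℝ≥0∞) := (PMF.expect_const_mul _ _ _).symm
    _ ≤ (ν.convPow n).expect fun x => (zlen x ^ 2 + s * s : ℝ≥0∞) := by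
        refine PMF.expect_mono fun x => ?_
        rcases le_total (s : ℝ≥0∞) (zlen x) with h | h
        · refine le_add_right ?_
          rw [sq]
          gcongr
        · refine le_add_left ?_
          gcongr
    _ = s * (((ν.expect fun z => (zlen z ^ 2 : ℝ≥0∞)) + 1) * s) := by
        rw [PMF.expect_add, PMF.expect_const, expect_zlen_sq hν, ← hss]
        ring

theorem expect_switchCountLaw_fst_le (hν : ν.IsSymmetric) (n : ℕ) :
    (ν.expect fun z => (zlen z : ℝ≥0∞)) * ((switchCountLaw ν n).expect fun q => (q.1 : ℝ≥0∞)) ≤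
      ((ν.convPow n).expect fun x => (zlen x : ℝ≥0∞)) +
        (ν.convPow (n + 1)).expect fun x => (zlen x : ℝ≥0∞) := by
  classical
  induction n with
  | zero => simp [switchCountLaw]
  | succ n ih =>
    have hcount : ((switchCountLaw ν (n + 1)).expect fun q => (q.1 : ℝ≥0∞)) =
        ((switchCountLaw ν n).expect fun q => (q.1 : ℝ≥0∞)) +
          ((ν.convPow n).expect fun x => if x = 1 then 1 else 0) +
          ((ν.convPow (n + 1)).expect fun x => if x = 1 then 1 else 0) := by
      rw [← expect_switchCountLaw_snd, ← expect_switchCountLaw_snd, expect_switchCountLaw_succ,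
        expect_switchCountLaw_succ]
      simp only [Nat.cast_add, Nat.cast_ite, Nat.cast_one, Nat.cast_zero, PMF.expect_add,
        PMF.expect_const]
    rw [hcount, mul_add, mul_add]
    refine (add_le_add (add_le_add ih le_rfl) le_rfl).trans ?_
    refine le_trans (le_of_eq ?_) (add_le_add (expect_zlen_add_le hν n)
      (expect_zlen_add_le hν (n + 1)))
    ring

/-- A nontrivial symmetric walk on `ℤ` revisits its final position `O(√n)` times on average. -/
theorem exists_expect_switchCountLaw_fst_le (hν : ν.IsSymmetric) (hfin : ν.support.Finite)
    (hne : ∃ z ∈ ν.support, z ≠ 1) : ∃ C : ℝ≥0, ∀ n : ℕ,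
      ((switchCountLaw ν n).expect fun q => (q.1 : ℝ≥0∞)) ≤ C * NNReal.sqrt n := by
  set σ₁ := ν.expect fun z => (zlen z : ℝ≥0∞) with hσ₁
  set σ₂ := ν.expect fun z => (zlen z ^ 2 : ℝ≥0∞) with hσ₂
  have h₁ : σ₁ ≠ ∞ := PMF.expect_ne_top hfin fun _ => ENNReal.natCast_ne_top _
  have h₂ : σ₂ ≠ ∞ := PMF.expect_ne_top hfin fun _ => by finiteness
  have h₀ : σ₁ ≠ 0 := by
    obtain ⟨z, hz, hz1⟩ := hne
    intro h
    have := ENNReal.tsum_eq_zero.1 h z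
    simp only [mul_eq_zero, Nat.cast_eq_zero] at this
    exact this.elim ((PMF.mem_support_iff _ _).1 hz) (zlen_ne_zero hz1)
  have hC : 3 * (σ₂ + 1) / σ₁ ≠ ∞ := by finiteness
  refine ⟨(3 * (σ₂ + 1) / σ₁).toNNReal, fun n => ?_⟩
  rw [ENNReal.coe_toNNReal hC]
  rcases Nat.eq_zero_or_pos n with rfl | hn
  · simp [switchCountLaw]
  refine (ENNReal.mul_le_mul_iff_right h₀ h₁).1 ?_
  have hsqrt : (NNReal.sqrt ((n + 1 : ℕ) : ℝ≥0) : ℝ≥0∞) ≤ 2 * NNReal.sqrt n := by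
    have h4 : NNReal.sqrt (4 * n) = 2 * NNReal.sqrt n := by
      rw [NNReal.sqrt_mul, show (4 : ℝ≥0) = 2 * 2 by norm_num, NNReal.sqrt_mul_self]
    have : NNReal.sqrt ((n + 1 : ℕ) : ℝ≥0) ≤ 2 * NNReal.sqrt n := by
      rw [← h4]
      refine NNReal.sqrt_le_sqrt.2 ?_
      exact_mod_cast (by omega : n + 1 ≤ 4 * n)
    exact_mod_cast this
  calc _ ≤ (σ₂ + 1) * NNReal.sqrt n + (σ₂ + 1) * NNReal.sqrt ((n + 1 : ℕ) : ℝ≥0) :=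
        (expect_switchCountLaw_fst_le hν n).trans
          (add_le_add (expect_zlen_le hν n) (expect_zlen_le hν (n + 1)))
    _ ≤ (σ₂ + 1) * NNReal.sqrt n + (σ₂ + 1) * (2 * NNReal.sqrt n) := by gcongr
    _ = 3 * (σ₂ + 1) * NNReal.sqrt n := by ring
    _ = σ₁ * (3 * (σ₂ + 1) / σ₁ * NNReal.sqrt n) := by
        rw [← mul_assoc, ENNReal.mul_div_cancel h₀ h₁]

end IntegerWalk

/-! ### The scale of the observed lamp in iterated wreath products -/

section Iteration

/-- `G` contains a copy of `H`, embedded by `ι`, and carries an `H`-valued observable `obs` which is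
multiplied by `b` when an element is right-translated by `ι b`; along the walk driven by `ρ` the
mean length of this observable is `O(n ^ p)`. -/
def HasEquivariantObservable {G H : Type*} [Group G] [Group H] (S : Finset H) (ρ : PMF G)
    (p : ℝ) : Prop :=
  ∃ (ι : H →* G) (obs : G → H), (∀ g b, obs (g * ι b) = obs g * b) ∧ ∃ C : ℝ≥0, ∀ n : ℕ,
    ((ρ.convPow n).expect fun g => (wordLength S (obs g) : ℝ≥0∞)) ≤ C * ((n : ℝ≥0) ^ p : ℝ≥0)

theorem NNReal.rpow_mul_rpow_one_sub_le_add {p : ℝ} (hp0 : 0 ≤ p) (hp1 : p ≤ 1) {s : ℝ≥0}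
    (hs : s ≠ 0) (m : ℝ≥0) : m ^ p * s ^ (1 - p) ≤ m + s := by
  rcases le_total m s with h | h
  · calc m ^ p * s ^ (1 - p) ≤ s ^ p * s ^ (1 - p) := by gcongr
      _ = s := by rw [← NNReal.rpow_add hs, add_sub_cancel, NNReal.rpow_one]
      _ ≤ m + s := le_add_self
  · have hm : m ≠ 0 := (hs.bot_lt.trans_le h).ne'
    calc m ^ p * s ^ (1 - p) ≤ m ^ p * m ^ (1 - p) := by
          gcongr
      _ = m := by rw [← NNReal.rpow_add hm, add_sub_cancel, NNReal.rpow_one]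
      _ ≤ m + s := le_self_add

/-- A weak form of Jensen's inequality for the concave function `x ^ p`. -/
theorem PMF.expect_rpow_le {α : Type*} (q : PMF α) (N : α → ℝ≥0) {p : ℝ} (hp0 : 0 ≤ p)
    (hp1 : p ≤ 1) {C s : ℝ≥0} (hs : s ≠ 0) (h : (q.expect fun x => (N x : ℝ≥0∞)) ≤ C * s) :
    (q.expect fun x => ((N x ^ p : ℝ≥0) : ℝ≥0∞)) ≤ (C + 1) * (s ^ p : ℝ≥0) := by
  have ht : s ^ (1 - p) ≠ 0 := by simp [NNReal.rpow_eq_zero_iff, hs]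
  refine (ENNReal.mul_le_mul_iff_right (a := (s ^ (1 - p) : ℝ≥0)) (ENNReal.coe_ne_zero.2 ht)
    ENNReal.coe_ne_top).1 ?_
  rw [← PMF.expect_const_mul]
  calc _ ≤ q.expect fun x => ((N x : ℝ≥0∞) + s) := by
        refine PMF.expect_mono fun x => ?_
        rw [mul_comm, ← ENNReal.coe_mul, ← ENNReal.coe_add, ENNReal.coe_le_coe]
        exact NNReal.rpow_mul_rpow_one_sub_le_add hp0 hp1 hs (N x)
    _ ≤ C * s + s := by
        rw [PMF.expect_add, PMF.expect_const]
        gcongr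
    _ = (s ^ (1 - p) : ℝ≥0) * ((C + 1) * (s ^ p : ℝ≥0)) := by
        have : s ^ (1 - p) * s ^ p = s := by
          rw [← NNReal.rpow_add hs, sub_add_cancel, NNReal.rpow_one]
        rw [mul_left_comm, ← ENNReal.coe_mul (s ^ (1 - p)), this, add_mul, one_mul]

/-- The final lamp makes about `√n` steps of the walk on `B`, so that a quantity of order `n ^ p`
for this walk is of order `n ^ (p / 2)` for the final lamp. -/
theorem exists_expect_lamp_le {B : Type*} [Group B] {ρ : PMF B} {ν : PMF (Multiplicative ℤ)}
    (hν : ν.IsSymmetric) (hfin : ν.support.Finite) (hne : ∃ z ∈ ν.support, z ≠ 1) {p : ℝ}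
    (hp0 : 0 < p) (hp1 : p ≤ 1) {ψ : B → ℝ≥0∞} {C : ℝ≥0}
    (hC : ∀ n : ℕ, (ρ.convPow n).expect ψ ≤ C * ((n : ℝ≥0) ^ p : ℝ≥0)) :
    ∃ C' : ℝ≥0, ∀ n : ℕ, (((switchWalkSwitch ν ρ).convPow n).expect fun w => ψ w.lamp) ≤
      C' * ((n : ℝ≥0) ^ (p / 2) : ℝ≥0) := by
  obtain ⟨C₁, hC₁⟩ := exists_expect_switchCountLaw_fst_le hν hfin hne
  refine ⟨C * (C₁ + 1), fun n => ?_⟩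
  rcases Nat.eq_zero_or_pos n with rfl | hn
  · have h0 := hC 0
    rw [PMF.expect_convPow_zero, Nat.cast_zero, NNReal.zero_rpow hp0.ne', ENNReal.coe_zero,
      mul_zero] at h0
    rw [PMF.expect_convPow_zero, Wreath.lamp_one]
    exact h0.trans zero_le
  have hs0 : NNReal.sqrt n ≠ 0 := by simpa using hn.ne'
  have hsp : (n : ℝ≥0) ^ (p / 2) = NNReal.sqrt n ^ p := by
    rw [NNReal.sqrt_eq_rpow, ← NNReal.rpow_mul, one_div_mul_eq_div]
  rw [expect_lamp_cursor ν ρ n fun b _ => ψ b, hsp]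
  have hmean : ((switchCountLaw ν n).expect fun q => (((q.1 : ℝ≥0) ^ p : ℝ≥0) : ℝ≥0∞)) ≤
      (C₁ + 1) * (NNReal.sqrt n ^ p : ℝ≥0) :=
    PMF.expect_rpow_le _ (fun q : ℕ × Multiplicative ℤ => (q.1 : ℝ≥0)) hp0.le hp1 hs0
      (by simpa only [ENNReal.coe_natCast] using hC₁ n)
  calc (switchCountLaw ν n).expect (fun q => (ρ.convPow q.1).expect ψ)
      ≤ (switchCountLaw ν n).expect fun q => C * (((q.1 : ℝ≥0) ^ p : ℝ≥0) : ℝ≥0∞) :=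
        PMF.expect_mono fun q => hC q.1
    _ ≤ C * ((C₁ + 1) * (NNReal.sqrt n ^ p : ℝ≥0)) := by
        rw [PMF.expect_const_mul]
        gcongr
    _ = _ := by
        rw [ENNReal.coe_mul, ENNReal.coe_add, ENNReal.coe_one, mul_assoc]

theorem HasEquivariantObservable.switchWalkSwitch {B H : Type*} [Group B] [Group H] {S : Finset H}
    {ρ : PMF B} {p : ℝ} (h : HasEquivariantObservable S ρ p) (hp0 : 0 < p) (hp1 : p ≤ 1)
    {ν : PMF (Multiplicative ℤ)} (hν : ν.IsSymmetric) (hfin : ν.support.Finite)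
    (hne : ∃ z ∈ ν.support, z ≠ 1) :
    HasEquivariantObservable S (switchWalkSwitch ν ρ) (p / 2) := by
  obtain ⟨ι, obs, hobs, C, hC⟩ := h
  refine ⟨(Wreath.switchHom (Multiplicative ℤ) B).comp ι, fun w => obs w.lamp, fun w b => ?_,
    exists_expect_lamp_le hν hfin hne hp0 hp1 hC⟩
  change obs _ = obs _ * b
  rw [MonoidHom.comp_apply, Wreath.lamp_mul_switchHom, hobs]

variable {H : Type u} [Group H] {S : Finset H} {μ : PMF H}

theorem hasEquivariantObservable_of_drift (hS : Subgroup.closure (S : Set H) = ⊤)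
    (hfin : μ.support.Finite)
    (hdrift : (fun n : ℕ => drift S μ n) =O[atTop] fun n : ℕ => Real.sqrt n) :
    HasEquivariantObservable S μ (1 / 2) := by
  refine ⟨MonoidHom.id H, id, fun _ _ => rfl, ?_⟩
  set L : ℕ → ℝ≥0∞ := fun n => (μ.convPow n).expect fun g => (wordLength S g : ℝ≥0∞) with hL
  set σ := μ.expect fun g => (wordLength S g : ℝ≥0∞)
  have hσ : σ ≠ ∞ := PMF.expect_ne_top hfin fun _ => ENNReal.natCast_ne_top _
  have hLσ : ∀ n : ℕ, L n ≤ n * σ := expect_wordLength_convPow_le hS μ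
  have hLtop : ∀ n, L n ≠ ∞ := fun n => ne_top_of_le_ne_top (by finiteness) (hLσ n)
  obtain ⟨c, hc⟩ := hdrift.bound
  obtain ⟨N, hN⟩ := eventually_atTop.1 hc
  refine ⟨c.toNNReal + N * σ.toNNReal, fun n => ?_⟩
  change L n ≤ _
  rw [← NNReal.sqrt_eq_rpow, ENNReal.coe_add, add_mul]
  rcases le_total N n with hn | hn
  · refine le_add_right ?_
    have h := hN n hn
    rw [drift_eq_toReal_expect, Real.norm_of_nonneg ENNReal.toReal_nonneg,
      Real.norm_of_nonneg (Real.sqrt_nonneg _)] at h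
    rw [← ENNReal.ofReal_toReal (hLtop n), ← ENNReal.coe_mul, ENNReal.ofReal,
      ENNReal.coe_le_coe, Real.toNNReal_le_iff_le_coe]
    refine h.trans ?_
    push_cast
    gcongr
    exact Real.le_coe_toNNReal c
  · refine le_add_left ?_
    rcases Nat.eq_zero_or_pos n with rfl | h0
    · simp [hL]
    have h1 : (1 : ℝ≥0∞) ≤ NNReal.sqrt n := by
      have : (1 : ℝ≥0) ≤ NNReal.sqrt n := by
        rw [NNReal.one_le_sqrt]
        exact_mod_cast h0
      exact_mod_cast this
    calc L n ≤ n * σ := hLσ n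
      _ ≤ N * σ := by gcongr
      _ ≤ N * σ * NNReal.sqrt n := le_mul_of_one_le_right' h1
      _ = _ := by rw [ENNReal.coe_mul, ENNReal.coe_toNNReal hσ, ENNReal.coe_natCast]

theorem exists_le_wordLength_of_drift
    (hdrift : (fun n : ℕ => Real.sqrt n) =O[atTop] fun n : ℕ => drift S μ n) (m : ℕ) :
    ∃ g : H, m ≤ wordLength S g := by
  by_contra! hlt
  have hle : ∀ n, drift S μ n ≤ m := fun n => by
    rw [drift_eq_toReal_expect]
    refine ENNReal.toReal_le_of_le_ofReal (by positivity) ?_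
    rw [ENNReal.ofReal_natCast, ← PMF.expect_const (μ.convPow n) (m : ℝ≥0∞)]
    exact PMF.expect_mono fun g => by exact_mod_cast (hlt g).le
  obtain ⟨c, hc0, hc⟩ := hdrift.exists_pos
  have hlim : Tendsto (fun n : ℕ => Real.sqrt n) atTop atTop :=
    Real.tendsto_sqrt_atTop.comp tendsto_natCast_atTop_atTop
  obtain ⟨n, hn, hn'⟩ := (hc.bound.and (hlim.eventually_gt_atTop (c * m))).exists
  rw [Real.norm_of_nonneg (Real.sqrt_nonneg _), Real.norm_of_nonneg
    (by rw [drift_eq_toReal_expect]; exact ENNReal.toReal_nonneg)] at hn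
  exact absurd (hn.trans (by gcongr; exact hle n)) hn'.not_ge

/-- The alternative keeps track of trivial `ν j`, for which the cursor of the `j`-th wreath product
stands still and the walk is confined to a proper subgroup. -/
theorem hasEquivariantObservable_iterated_or
    (h : HasEquivariantObservable S μ (1 / 2)) (i : ℕ) {ν : ℕ → PMF (Multiplicative ℤ)}
    (hν_symm : ∀ j < i, (ν j).IsSymmetric) (hν_fin : ∀ j < i, (ν j).support.Finite) :
    HasEquivariantObservable S (iteratedSwitchWalkSwitch ν μ i) (1 / 2 ^ (i + 1)) ∨
      ∃ K : Subgroup (IteratedWreath H i), K ≠ ⊤ ∧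
        (iteratedSwitchWalkSwitch ν μ i).support ⊆ K := by
  induction i with
  | zero =>
    left
    simpa using! h
  | succ i ih =>
    by_cases hne : ∃ z ∈ (ν i).support, z ≠ 1
    · rcases ih (fun j hj => hν_symm j (hj.trans i.lt_succ_self))
        (fun j hj => hν_fin j (hj.trans i.lt_succ_self)) with h | ⟨K, hK, hsupp⟩
      · left
        have h' := h.switchWalkSwitch (by positivity)
          (div_le_one_of_le₀ (one_le_pow₀ one_le_two) (by positivity))
          (hν_symm i i.lt_succ_self) (hν_fin i i.lt_succ_self) hne
        rwa [div_div, ← pow_succ] at h'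
      · exact .inr ⟨Wreath.lampSubgroup _ K, Wreath.lampSubgroup_ne_top hK,
          support_switchWalkSwitch_subset_lampSubgroup _ hsupp⟩
    · push Not at hne
      exact .inr ⟨(Wreath.cursorHom _ _).ker, Wreath.ker_cursorHom_ne_top,
        support_switchWalkSwitch_subset_ker_cursorHom hne _⟩

end Iteration

theorem mainTheorem10 {H : Type u} [Group H]
    (S : Finset H) (hS : Subgroup.closure (S : Set H) = ⊤)
    (μ : PMF H) (hμ_symm : μ.IsSymmetric) (hμ_fin : μ.support.Finite)
    (hμ_drift : (fun n : ℕ => drift S μ n) =Θ[atTop] fun n : ℕ => Real.sqrt n)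
    (i : ℕ) (ν : ℕ → PMF (Multiplicative ℤ))
    (hν_symm : ∀ j < i, (ν j).IsSymmetric) (hν_fin : ∀ j < i, (ν j).support.Finite)
    (T : Finset (IteratedWreath H i))
    (hT : Subgroup.closure (T : Set (IteratedWreath H i)) = ⊤) :
    IndividualRadiusPreceq T (iteratedSwitchWalkSwitch ν μ i)
      (fun n : ℕ => (n : ℝ≥0) ^ ((1 : ℝ) / 2 ^ (i + 1))) := by
  have hr : ∀ n : ℕ, 1 ≤ n → 1 ≤ (n : ℝ≥0) ^ ((1 : ℝ) / 2 ^ (i + 1)) := fun n hn =>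
    NNReal.one_le_rpow (by exact_mod_cast hn) (by positivity)
  rcases hasEquivariantObservable_iterated_or
    (hasEquivariantObservable_of_drift hS hμ_fin hμ_drift.1) i hν_symm hν_fin with
    ⟨ι, obs, hobs, C, hC⟩ | ⟨K, hK, hsupp⟩
  · exact individualRadiusPreceq_of_expect_le hS hT (exists_le_wordLength_of_drift hμ_drift.2)
      ι obs hobs hr hC
  · exact individualRadiusPreceq_of_support_subset T hK hsupp hr
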